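/- Let $\Omega=[0,1]$ with the Borel $\sigma$-algebra and Lebesgue measure $\mathsf P$, let $T=1$ and let $\mathcal F_0$ be trivial. Let $S_0>0$ be a constant (the common bid and ask price at time $0$), and let $\underline S_1,\overline S_1\in L^\infty$ be the bid and ask prices at time $1$, with $\underline S_1>0$ and $\overline S_1-\underline S_1\ge\alpha$ a.s. for some real $\alpha>0$. Let $U:\mathbb R\to\mathbb R$ be concave and nondecreasing. For $\gamma\in\mathbb R$ put $$X_1(\gamma)=1+\gamma^+(\underline S_1-S_0)-\gamma^-(\overline S_1-S_0),\qquad \lambda=\sup_{\gamma\in\mathbb R}\mathsf E U(X_1(\gamma)).$$ Let $\mathcal X$ be the set of pairs $S=(S_0,S_1)$ with $S_1\in L^1$, $\underline S_1\le S_1\le\overline S_1$ a.s., endowed with the weak topology $\sigma(L^1,L^\infty)$. For $S\in\mathcal X$, $\gamma\in\mathbb R$ put $\Psi(S,\gamma)=\mathsf E U(1+\gamma(S_1-S_0))$ and let $\widehat\Psi(\cdot,\gamma)$ be the lower semicontinuous envelope of $\Psi(\cdot,\gamma)$ on $\mathcal X$, i.e. $\widehat\Psi(S,\gamma)=\sup_V\inf_{S'\in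 V}\Psi(S',\gamma)$, where $V$ runs through the neighbourhoods of $S$ in $\mathcal X$. Call $S\in\mathcal X$ a shadow price if $\sup_{\gamma}\Psi(S,\gamma)=\lambda$, and a generalized shadow price if $\sup_{\gamma}\widehat\Psi(S,\gamma)=\lambda$. Call $(S^*,\gamma^*)$ a saddle point of $\widehat\Psi$ if $\widehat\Psi(S^*,\gamma)\le\widehat\Psi(S^*,\gamma^*)\le\widehat\Psi(S,\gamma^*)$ for all $S\in\mathcal X$, $\gamma\in\mathbb R$. Then: (1) For all $S\in\mathcal X$ and $\gamma\in\mathbb R$, $$\widehat\Psi(S,\gamma)=\mathsf E\Bigl(U(1+\gamma(\overline S_1-S_0))\frac{S_1-\underline S_1}{\overline S_1-\underline S_1}+U(1+\gamma(\underline S_1-S_0))\frac{\overline S_1-S_1}{\overline S_1-\underline S_1}\Bigr),$$ where the random variable under the expectation is integrable. (2) If $U$ is strictly concave then $\widehat\Psi\ne\Psi$; more precisely, for every $\gamma\neq0$ there is $S\in\mathcal X$ with $\widehat\Psi(S,\gamma)<\Psi(S,\gamma)$. (3) Assume in addition that $U$ is strictly increasing and differentiable. Then $(S_1^*-S_0)U'(1+\gamma^*(S_1^*-S_0))$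 is integrable for all $S^*\in\mathcal X$, $\gamma^*\in\mathbb R$, and $(S^*,\gamma^*)$ is a saddle point of $\widehat\Psi$ if and only if $$S_1^*I_{\{\gamma^*\ne0\}}=\underline S_1I_{\{\gamma^*>0\}}+\overline S_1I_{\{\gamma^*<0\}}\quad\text{a.s.}\qquad\text{and}\qquad \mathsf E\bigl((S_1^*-S_0)U'(1+\gamma^*(S_1^*-S_0))\bigr)=0.$$ Moreover, under the first of these two conditions, the finite-valued function $\gamma\mapsto\widehat\Psi(S^*,\gamma)$ is differentiable at $\gamma^*$ and $\frac{\partial\widehat\Psi}{\partial\gamma}(S^*,\gamma^*)$ equals the left-hand side of the second one. (4) Under the assumptions of (3), suppose that there exists an optimal solution $\gamma^*$, i.e. $\mathsf E U(X_1(\gamma^*))=\lambda$. Then for every $S\in\mathcal X$ and every such $\gamma^*$: $S$ is a generalized shadow price if and only if $(S,\gamma^*)$ is a saddle point of $\widehat\Psi$; and $S$ is a generalized shadow price if and only if $S$ is a shadow price. -/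

import Mathlib

open MeasureTheory Topology
open scoped ENNReal unitInterval

noncomputable section

namespace ShadowPrice

/-- `L¹` of `[0,1]` (Borel σ-algebra, Lebesgue measure) with the weak topology `σ(L¹, L^∞)`, given
by the pairing `(f, g) ↦ 𝔼[f g]`. -/
abbrev WeakL1 : Type :=
  WeakBilin (((ContinuousLinearMap.mul ℝ ℝ).lpPairing (volume : Measure I) 1 ∞).toLinearMap₁₂)

/-- A representative of an element of `L¹`. -/
def WeakL1.val (f : WeakL1) : I → ℝ :=
  fun ω => (show Lp ℝ 1 (volume : Measure I) from f) ω

/-- A one-period (`T = 1`) bid/ask model on `[0,1]` with Lebesgue measure. The σ-algebra at time `0`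
is trivial, so prices at time `0` are real constants; the σ-algebra at time `1` is the Borel one,
and prices at time `1` belong to `L^∞`. -/
structure Model where
  bid₀ : ℝ
  ask₀ : ℝ
  bid₁ : I → ℝ
  ask₁ : I → ℝ
  bid₀_pos : 0 < bid₀
  bid₀_le_ask₀ : bid₀ ≤ ask₀
  bid₁_pos : ∀ᵐ ω, 0 < bid₁ ω
  bid₁_le_ask₁ : ∀ᵐ ω, bid₁ ω ≤ ask₁ ω
  bid₁_memLp : MemLp bid₁ ∞
  ask₁_memLp : MemLp ask₁ ∞

/-- The expected utility `𝔼 U(X)` with values in `[-∞, ∞]`, as the expectation of the positive part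
minus the expectation of the negative part of `U(X)`. -/
def expectedUtility (U : ℝ → ℝ) (X : I → ℝ) : EReal :=
  ((∫⁻ ω, ENNReal.ofReal (U (X ω)) : ℝ≥0∞) : EReal)
    - ((∫⁻ ω, ENNReal.ofReal (-U (X ω)) : ℝ≥0∞) : EReal)

namespace Model

variable (M : Model)

/-- The terminal wealth `X₁(γ) = 1 + ∑_{t=0}^{1} (bid_t (Δγ_t)⁻ - ask_t (Δγ_t)⁺)` of the trader with
`γ_{-1} = 0`, `γ_0 = γ`, `γ_1 = 0`, so that `Δγ_0 = γ - 0` and `Δγ_1 = 0 - γ`. -/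
def wealth (γ : ℝ) (ω : I) : ℝ :=
  1 + (M.bid₀ * max (-(γ - 0)) 0 - M.ask₀ * max (γ - 0) 0)
    + (M.bid₁ ω * max (-(0 - γ)) 0 - M.ask₁ ω * max (0 - γ) 0)

/-- The optimal value `λ` of the utility maximization problem under transaction costs. -/
def value (U : ℝ → ℝ) : EReal := ⨆ γ : ℝ, expectedUtility U (M.wealth γ)

/-- `γ` is an optimal solution of the utility maximization problem under transaction costs. -/
def IsOptimal (U : ℝ → ℝ) (γ : ℝ) : Prop := expectedUtility U (M.wealth γ) = M.value U

/-- The set of adapted price processes `S = (S_0, S_1)` with `bid ≤ S ≤ ask`; as a subset of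
`ℝ × L¹` it carries the product of the usual topology of `ℝ` and the weak topology of `L¹`. -/
def priceInterval : Set (ℝ × WeakL1) :=
  {S | M.bid₀ ≤ S.1 ∧ S.1 ≤ M.ask₀ ∧ ∀ᵐ ω, M.bid₁ ω ≤ S.2.val ω ∧ S.2.val ω ≤ M.ask₁ ω}

variable {M}

/-- The price at time `0`. -/
def price₀ (S : M.priceInterval) : ℝ := S.1.1

/-- The price at time `1`. -/
def price₁ (S : M.priceInterval) : I → ℝ := S.1.2.val

/-- `Ψ(S, γ) = 𝔼 U(1 + γ (S_1 - S_0))`, the utility of the strategy `γ` in the frictionless model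
with price process `S`. -/
def frictionlessUtility (U : ℝ → ℝ) (S : M.priceInterval) (γ : ℝ) : EReal :=
  expectedUtility U fun ω => 1 + γ * (price₁ S ω - price₀ S)

/-- The relaxed utility `Ψ̂(·, γ)`: the lower semicontinuous envelope of `Ψ(·, γ)` on the price
interval, `Ψ̂(S, γ) = sup_{V ∈ 𝓝(S)} inf_{S' ∈ V} Ψ(S', γ)`. -/
def relaxedUtility (U : ℝ → ℝ) (S : M.priceInterval) (γ : ℝ) : EReal :=
  ⨆ V ∈ 𝓝 S, ⨅ S' ∈ V, frictionlessUtility U S' γ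

/-- `S` is a shadow price: the optimal utility value `μ_S` in the frictionless model with price `S`
equals `λ`. -/
def IsShadowPrice (U : ℝ → ℝ) (S : M.priceInterval) : Prop :=
  ⨆ γ : ℝ, frictionlessUtility U S γ = M.value U

/-- `S` is a generalized shadow price: the optimal value of the relaxed utility equals `λ`. -/
def IsGeneralizedShadowPrice (U : ℝ → ℝ) (S : M.priceInterval) : Prop :=
  ⨆ γ : ℝ, relaxedUtility U S γ = M.value U

/-- `(S, γ)` is a saddle point of `Ψ̂`. -/
def IsSaddlePoint (U : ℝ → ℝ) (S : M.priceInterval) (γ : ℝ) : Prop :=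
  ∀ (S' : M.priceInterval) (γ' : ℝ),
    relaxedUtility U S γ' ≤ relaxedUtility U S γ ∧ relaxedUtility U S γ ≤ relaxedUtility U S' γ

open Classical in
/-- The almost sure equality `S_1 1_{γ ≠ 0} = bid_1 1_{γ > 0} + ask_1 1_{γ < 0}`. -/
def ExtremalPrice (S : M.priceInterval) (γ : ℝ) : Prop :=
  ∀ᵐ ω, (if γ ≠ 0 then price₁ S ω else 0)
    = (if 0 < γ then M.bid₁ ω else 0) + (if γ < 0 then M.ask₁ ω else 0)

/-- `(S_1 - S_0) U'(1 + γ (S_1 - S_0))`, the marginal utility. -/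
def marginalUtility (U : ℝ → ℝ) (S : M.priceInterval) (γ : ℝ) (ω : I) : ℝ :=
  (price₁ S ω - price₀ S) * deriv U (1 + γ * (price₁ S ω - price₀ S))

/-- The linear interpolation, at the point `S_1`, of `x ↦ U(1 + γ (x - S_0))` between its values at
`bid_1` and `ask_1`. -/
def interpolatedUtility (U : ℝ → ℝ) (S : M.priceInterval) (γ : ℝ) (ω : I) : ℝ :=
  U (1 + γ * (M.ask₁ ω - price₀ S)) * ((price₁ S ω - M.bid₁ ω) / (M.ask₁ ω - M.bid₁ ω))
    + U (1 + γ * (M.bid₁ ω - price₀ S)) * ((M.ask₁ ω - price₁ S ω) / (M.ask₁ ω - M.bid₁ ω))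

end Model

end ShadowPrice

end

namespace ShadowPrice

open Filter Set

/-! Lebesgue measure has no atoms, so every price is a weak limit of prices that oscillate between
bid and ask (`exists_tendsto_extreme`). Along such prices the frictionless utility equals the
integral of the chord of `x ↦ U(1 + γ(x - S₀))` through bid and ask. Concavity puts the chord below
the utility at every price. The chord integral is affine and weakly continuous in `S₁`, because a
spread bounded away from zero keeps its coefficients bounded. Hence it is the lower semicontinuous
envelope (`relaxedUtility_eq`).

The rest concerns concave functions of `γ`. Under transaction costs a position is liquidated at the
less favourable endpoint, so the utility of the wealth lies below the chord. If `U` is strictly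
increasing, equality of the integrals characterises the extremal prices
(`integral_utility_wealth_eq_iff`). An extremal price exists for every `γ`, so minimality in `S` is
extremality. By concavity, maximality in `γ` is a vanishing derivative, and at an extremal price
that derivative is the expected marginal utility. This gives `isSaddlePoint_iff`.

For shadow prices, `λ ≤ sup Ψ̂ ≤ sup Ψ` always holds. At a generalized shadow price the first-order
condition at an optimal `γ` is also that of `Ψ(S, ·)`, and `Ψ = Ψ̂` there, so both inequalities are
equalities. -/

/-! ### Weak approximation of `[0,1]`-valued functions by indicators -/

lemma exists_setIntegral_indicator_Iic_eq {θ : I → ℝ} (hθ : Integrable θ)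
    (h0 : ∀ᵐ ω, 0 ≤ θ ω) (h1 : ∀ᵐ ω, θ ω ≤ 1) (P : Set I) :
    ∃ t : I, ∫ ω in P, (Iic t).indicator (fun _ => (1 : ℝ)) ω = ∫ ω in P, θ ω := by
  have hcont : Continuous fun t : I => ∫ ω in P, (Iic t).indicator (fun _ => (1 : ℝ)) ω := by
    refine continuous_iff_continuousAt.2 fun t => ?_
    refine continuousAt_of_dominated (bound := fun _ => 1)
      (Eventually.of_forall fun x =>
        (aestronglyMeasurable_const.indicator measurableSet_Iic))
      (Eventually.of_forall fun x => Eventually.of_forall fun ω => ?_) (integrable_const _) ?_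
    · simp only [indicator]; split_ifs <;> simp
    -- Away from the null set `{t}` the integrand is locally constant in the threshold.
    · have hne : ∀ᵐ ω ∂(volume.restrict P), ω ≠ t :=
        ae_restrict_of_ae (measure_eq_zero_iff_ae_notMem.1 (measure_singleton t))
      filter_upwards [hne] with ω hω
      rcases lt_or_gt_of_ne hω with h | h
      · refine continuousAt_const (y := (1 : ℝ)) |>.congr ?_
        filter_upwards [lt_mem_nhds h] with x hx
        simp [indicator, hx.le]
      · refine continuousAt_const (y := (0 : ℝ)) |>.congr ?_
        filter_upwards [gt_mem_nhds h] with x hx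
        simp [indicator, hx]
  refine mem_range_of_exists_le_of_exists_ge hcont ⟨0, ?_⟩ ⟨1, ?_⟩
  · have : ∀ᵐ ω ∂(volume.restrict P), (Iic (0 : I)).indicator (fun _ => (1 : ℝ)) ω = 0 := by
      filter_upwards [ae_restrict_of_ae
        (measure_eq_zero_iff_ae_notMem.1 (measure_singleton (0 : I)))] with ω hω
      refine indicator_of_notMem (fun h => hω ?_) _
      exact le_antisymm h (unitInterval.nonneg')
    rw [integral_congr_ae this, integral_zero]
    exact integral_nonneg_of_ae (ae_restrict_of_ae h0)
  · refine integral_mono_ae hθ.integrableOn ((integrable_const 1).indicator measurableSet_Iic) ?_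
    filter_upwards [ae_restrict_of_ae h1] with ω hω
    simpa [indicator, unitInterval.le_one'] using hω

/-- Each fibre of `q` gets its own threshold. The glued set is measurable because `q` takes
countably many values. -/
lemma exists_measurableSet_setIntegral_fiber_eq_zero {θ : I → ℝ} (hθ : Integrable θ)
    (h0 : ∀ᵐ ω, 0 ≤ θ ω) (h1 : ∀ᵐ ω, θ ω ≤ 1) {q : I → ℕ} (hq : Measurable q) :
    ∃ A : Set I, MeasurableSet A ∧
      ∀ k, ∫ ω in q ⁻¹' {k}, (A.indicator (fun _ => (1 : ℝ)) ω - θ ω) = 0 := by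
  choose t ht using fun k : ℕ => exists_setIntegral_indicator_Iic_eq hθ h0 h1 (q ⁻¹' {k})
  have hA : MeasurableSet {ω : I | ω ≤ t (q ω)} :=
    measurableSet_le measurable_id ((measurable_of_countable t).comp hq)
  refine ⟨{ω | ω ≤ t (q ω)}, hA, fun k => ?_⟩
  rw [integral_sub ((integrable_const _).indicator hA) hθ.integrableOn, ← ht k, sub_eq_zero]
  refine setIntegral_congr_fun (hq (measurableSet_singleton k)) fun ω hω => ?_
  have : q ω = k := hω
  simp [indicator, this]

lemma integral_mul_comp_eq_zero {η : I → ℝ} {q : I → ℕ} (hq : Measurable q)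
    (hfib : ∀ k, ∫ ω in q ⁻¹' {k}, η ω = 0) {F : ℕ → ℝ}
    (hint : Integrable fun ω => η ω * F (q ω)) : ∫ ω, η ω * F (q ω) = 0 := by
  have hU : ⋃ k, q ⁻¹' {k} = univ := by ext; simp
  have h := hasSum_integral_iUnion (μ := (volume : Measure I)) (s := fun k : ℕ => q ⁻¹' {k})
    (fun k => hq (measurableSet_singleton k))
    (fun i j hij => Disjoint.preimage q (by simpa using hij)) (hint.integrableOn)
  have hz : ∀ k, ∫ ω in q ⁻¹' {k}, η ω * F (q ω) = 0 := fun k => by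
    rw [setIntegral_congr_fun (g := fun ω => η ω * F k) (hq (measurableSet_singleton k))
      (fun ω hω => by rw [show q ω = k from hω]), integral_mul_const, hfib, zero_mul]
  simp only [hz, hU, Measure.restrict_univ] at h
  exact h.unique hasSum_zero

/-- A bounded function with mean zero on every cell of mesh `1/n` integrates to zero against
cellwise constant functions. Continuous functions are uniformly close to these, and are dense in
`L¹`. -/
lemma tendsto_integral_mul_of_fiber {η : ℕ → I → ℝ}
    (hmeas : ∀ n, AEStronglyMeasurable (η n)) (hbd : ∀ n, ∀ᵐ ω, |η n ω| ≤ 1)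
    (hfib : ∀ (n : ℕ) (k : ℕ), ∫ ω in (fun ω : I => ⌊(n : ℝ) * ω⌋₊) ⁻¹' {k}, η n ω = 0)
    {g : I → ℝ} (hg : Integrable g) :
    Tendsto (fun n => ∫ ω, η n ω * g ω) atTop (𝓝 0) := by
  rw [Metric.tendsto_atTop]
  intro ε hε
  obtain ⟨f, -, hfg, hfc, hfi⟩ := hg.exists_hasCompactSupport_integral_sub_le (half_pos hε)
  have huc := CompactSpace.uniformContinuous_of_continuous hfc
  obtain ⟨δ, hδ, hfδ⟩ := Metric.uniformContinuous_iff.1 huc (ε / 4) (by positivity)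
  obtain ⟨N, hN⟩ := exists_nat_gt δ⁻¹
  refine ⟨N, fun n hn => ?_⟩
  have hn0 : (0 : ℝ) < n := (inv_pos.2 hδ).trans (hN.trans_le (by exact_mod_cast hn))
  have hnδ : (n : ℝ)⁻¹ < δ := inv_lt_of_inv_lt₀ hδ (hN.trans_le (by exact_mod_cast hn))
  -- `F` samples `f` at the left end of a cell; the projection only makes it total in `k`.
  set F : ℕ → ℝ := fun k => f (projIcc 0 1 zero_le_one ((k : ℝ) / n)) with hF
  have hq : Measurable fun ω : I => ⌊(n : ℝ) * ω⌋₊ :=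
    Nat.measurable_floor.comp (measurable_const.mul measurable_subtype_coe)
  have hclose : ∀ ω : I, |f ω - F ⌊(n : ℝ) * ω⌋₊| ≤ ε / 4 := fun ω => by
    refine (hfδ ?_).le
    have hfl := Nat.floor_le (mul_nonneg hn0.le ω.2.1)
    have hlt := Nat.lt_floor_add_one ((n : ℝ) * ω)
    have h1 : (⌊(n : ℝ) * ω⌋₊ : ℝ) / n ≤ ω := by rw [div_le_iff₀ hn0]; linarith
    have h2 : (ω : ℝ) < (⌊(n : ℝ) * ω⌋₊ : ℝ) / n + (n : ℝ)⁻¹ := by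
      rw [inv_eq_one_div, ← add_div, lt_div_iff₀ hn0]; linarith
    rw [projIcc_of_mem zero_le_one ⟨by positivity, h1.trans ω.2.2⟩, Subtype.dist_eq,
      Real.dist_eq, abs_of_nonneg (by simpa using h1)]
    simp only
    linarith
  have hFm : Measurable fun ω : I => F ⌊(n : ℝ) * ω⌋₊ := (measurable_of_countable F).comp hq
  obtain ⟨C, hC⟩ := isCompact_univ.exists_bound_of_continuousOn hfc.continuousOn
  have hFi : Integrable fun ω : I => F ⌊(n : ℝ) * ω⌋₊ :=
    .of_bound hFm.aestronglyMeasurable C (Eventually.of_forall fun ω => hC _ (mem_univ _))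
  have hηi : ∀ {h : I → ℝ}, Integrable h → Integrable fun ω => η n ω * h ω := fun hh =>
    hh.bdd_mul (hmeas n) (c := 1) (by simpa [Real.norm_eq_abs] using hbd n)
  have hz := integral_mul_comp_eq_zero hq (hfib n) (hηi hFi)
  have hb : ∀ {h : I → ℝ}, Integrable h → |∫ ω, η n ω * h ω| ≤ ∫ ω, |h ω| := fun {h} hh => by
    refine abs_integral_le_integral_abs.trans (integral_mono_ae (hηi hh).abs hh.abs ?_)
    filter_upwards [hbd n] with ω hω
    rw [abs_mul]
    exact mul_le_of_le_one_left (abs_nonneg _) hω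
  have e : ∫ ω, η n ω * g ω = (∫ ω, η n ω * (g ω - f ω))
      + ∫ ω, η n ω * (f ω - F ⌊(n : ℝ) * ω⌋₊) := by
    simp only [mul_sub]
    rw [integral_sub (hηi hg) (hηi hfi), integral_sub (hηi hfi) (hηi hFi), hz]
    ring
  have b1 := hb (hg.sub hfi)
  have b2 := hb (hfi.sub hFi)
  have b3 : ∫ ω : I, |f ω - F ⌊(n : ℝ) * ω⌋₊| ≤ ε / 4 := by
    refine (integral_mono (hfi.sub hFi).abs (integrable_const (ε / 4)) hclose).trans ?_
    simp
  simp only [Pi.sub_apply] at b1 b2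
  simp only [Real.norm_eq_abs] at hfg
  rw [Real.dist_eq, sub_zero, e]
  refine (abs_add_le _ _).trans_lt ?_
  linarith

theorem exists_tendsto_integral_indicator_mul {θ : I → ℝ} (hθ : Integrable θ)
    (h0 : ∀ᵐ ω, 0 ≤ θ ω) (h1 : ∀ᵐ ω, θ ω ≤ 1) :
    ∃ A : ℕ → Set I, (∀ n, MeasurableSet (A n)) ∧ ∀ g : I → ℝ, Integrable g →
      Tendsto (fun n => ∫ ω, ((A n).indicator (fun _ => 1) ω - θ ω) * g ω) atTop (𝓝 0) := by
  have hq : ∀ n : ℕ, Measurable fun ω : I => ⌊(n : ℝ) * ω⌋₊ := fun n =>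
    Nat.measurable_floor.comp (measurable_const.mul measurable_subtype_coe)
  choose A hA hfib using fun n =>
    exists_measurableSet_setIntegral_fiber_eq_zero hθ h0 h1 (hq n)
  refine ⟨A, hA, fun g hg => tendsto_integral_mul_of_fiber (fun n => ?_) (fun n => ?_) hfib hg⟩
  · exact (aestronglyMeasurable_const.indicator (hA n)).sub hθ.aestronglyMeasurable
  · filter_upwards [h0, h1] with ω h h'
    simp only [indicator]
    split_ifs <;> rw [abs_le] <;> constructor <;> linarith

/-! ### Essentially bounded functions and expected utility -/

lemma memLp_top_mul {f g : I → ℝ} (hf : MemLp f ∞) (hg : MemLp g ∞) :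
    MemLp (fun ω => f ω * g ω) ∞ :=
  hg.mul' hf

lemma _root_.MeasureTheory.MemLp.integrable_of_top {f : I → ℝ} (hf : MemLp f ∞) : Integrable f :=
  hf.integrable le_top

lemma memLp_top_of_between {f g h : I → ℝ} (hf : MemLp f ∞) (hh : MemLp h ∞)
    (hg : AEStronglyMeasurable g) (hfgh : ∀ᵐ ω, f ω ≤ g ω ∧ g ω ≤ h ω) : MemLp g ∞ := by
  refine (hf.norm.add hh.norm).of_le hg ?_
  filter_upwards [hfgh] with ω hω
  simp only [Pi.add_apply, Real.norm_eq_abs]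
  rw [abs_of_nonneg (add_nonneg (abs_nonneg (f ω)) (abs_nonneg (h ω))), abs_le]
  constructor
  · linarith [neg_abs_le (f ω), abs_nonneg (h ω)]
  · linarith [le_abs_self (h ω), abs_nonneg (f ω)]

lemma exists_ae_abs_le_of_memLp_top {X : I → ℝ} (hX : MemLp X ∞) :
    ∃ C : ℝ, 0 ≤ C ∧ ∀ᵐ ω, |X ω| ≤ C := by
  have hfin : eLpNormEssSup X volume ≠ ∞ := by
    simpa only [eLpNorm_exponent_top] using hX.eLpNorm_ne_top
  refine ⟨(eLpNormEssSup X volume).toReal, ENNReal.toReal_nonneg, ?_⟩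
  filter_upwards [enorm_ae_le_eLpNormEssSup X volume] with ω hω
  simpa using ENNReal.toReal_mono hfin hω

/-- Monotonicity alone gives measurability and the bounds `V (-C)`, `V C`. It serves both for `U`
and, through `-U'`, for the derivative. -/
lemma memLp_top_monotone_comp {V : ℝ → ℝ} (hV : Monotone V) {X : I → ℝ} (hX : MemLp X ∞) :
    MemLp (fun ω => V (X ω)) ∞ := by
  obtain ⟨C, -, hC⟩ := exists_ae_abs_le_of_memLp_top hX
  refine memLp_top_of_between (memLp_const (V (-C))) (memLp_const (V C))
    (hV.measurable.comp_aemeasurable hX.aestronglyMeasurable.aemeasurable).aestronglyMeasurable ?_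
  filter_upwards [hC] with ω hω
  exact ⟨hV (abs_le.1 hω).1, hV (abs_le.1 hω).2⟩

lemma memLp_top_gain {f : I → ℝ} (hf : MemLp f ∞) (γ s : ℝ) :
    MemLp (fun ω => 1 + γ * (f ω - s)) ∞ :=
  MemLp.add (f := fun _ => (1 : ℝ)) (g := fun ω => γ * (f ω - s)) (memLp_const 1)
    (MemLp.const_mul (f := fun ω => f ω - s)
      (MemLp.sub (g := fun _ => s) hf (memLp_const s)) γ)

lemma memLp_top_utility {U : ℝ → ℝ} (hmono : Monotone U) {f : I → ℝ} (hf : MemLp f ∞)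
    (γ s : ℝ) : MemLp (fun ω => U (1 + γ * (f ω - s))) ∞ :=
  memLp_top_monotone_comp hmono (memLp_top_gain hf γ s)

lemma expectedUtility_eq_integral {U : ℝ → ℝ} {X : I → ℝ} (h : Integrable fun ω => U (X ω)) :
    expectedUtility U X = ((∫ ω, U (X ω) : ℝ) : EReal) := by
  rw [integral_eq_lintegral_pos_part_sub_lintegral_neg_part h, EReal.coe_sub,
    EReal.coe_ennreal_toReal, EReal.coe_ennreal_toReal, expectedUtility]
  · exact ((lintegral_mono fun ω => Real.ofReal_le_enorm _).trans_lt
      h.neg.hasFiniteIntegral).ne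
  · exact ((lintegral_mono fun ω => Real.ofReal_le_enorm _).trans_lt h.hasFiniteIntegral).ne

lemma ae_eq_zero_of_integral_eq_zero {f : I → ℝ} (hf : Integrable f) (h0 : ∀ᵐ ω, 0 ≤ f ω)
    (h : ∫ ω, f ω = 0) : ∀ᵐ ω, f ω = 0 :=
  (integral_eq_zero_iff_of_nonneg_ae h0 hf).1 h

/-! ### The price interval and its weak topology -/

namespace Model

variable {M : Model}

lemma bid_le_price (S : M.priceInterval) : ∀ᵐ ω, M.bid₁ ω ≤ price₁ S ω ∧ price₁ S ω ≤ M.ask₁ ω :=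
  S.2.2.2

lemma price₀_eq (h₀ : M.bid₀ = M.ask₀) (S : M.priceInterval) : price₀ S = M.bid₀ :=
  le_antisymm (S.2.2.1.trans h₀.ge) S.2.1

lemma memLp_price₁ (S : M.priceInterval) : MemLp (price₁ S) ∞ :=
  memLp_top_of_between M.bid₁_memLp M.ask₁_memLp (Lp.aestronglyMeasurable (p := 1) S.1.2)
    (bid_le_price S)

/-- The price process with initial price `bid₀` and terminal price `f`. -/
noncomputable def priceOf {f : I → ℝ} (hf : MemLp f ∞)
    (hM : ∀ᵐ ω, M.bid₁ ω ≤ f ω ∧ f ω ≤ M.ask₁ ω) : M.priceInterval :=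
  ⟨(M.bid₀, ((hf.mono_exponent le_top).toLp f : Lp ℝ 1 (volume : Measure I))), le_rfl,
    M.bid₀_le_ask₀, by
      have h := (hf.mono_exponent (p := 1) le_top).coeFn_toLp
      filter_upwards [h, hM] with ω h1 h2
      have h1' : WeakL1.val ((hf.mono_exponent (p := 1) le_top).toLp f) ω = f ω := h1
      simpa only [h1'] using h2⟩

lemma price₁_priceOf {f : I → ℝ} (hf : MemLp f ∞)
    (hM : ∀ᵐ ω, M.bid₁ ω ≤ f ω ∧ f ω ≤ M.ask₁ ω) : price₁ (priceOf hf hM) =ᵐ[volume] f :=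
  (hf.mono_exponent (p := 1) le_top).coeFn_toLp

lemma weakPairing_eq_integral (S : M.priceInterval) (g : Lp ℝ ∞ (volume : Measure I)) :
    ((ContinuousLinearMap.mul ℝ ℝ).lpPairing (volume : Measure I) 1 ∞).toLinearMap₁₂ S.1.2 g
      = ∫ ω, price₁ S ω * g ω :=
  (ContinuousLinearMap.mul ℝ ℝ).lpPairing_eq_integral _ _

lemma continuous_integral_price_mul {d : I → ℝ} (hd : MemLp d ∞) :
    Continuous fun S : M.priceInterval => ∫ ω, price₁ S ω * d ω := by
  have h := (WeakBilin.eval_continuous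
    (((ContinuousLinearMap.mul ℝ ℝ).lpPairing (volume : Measure I) 1 ∞).toLinearMap₁₂)
    (hd.toLp d)).comp (continuous_snd.comp (continuous_subtype_val (p := (· ∈ M.priceInterval))))
  refine h.congr fun S => ?_
  refine (weakPairing_eq_integral S _).trans (integral_congr_ae ?_)
  filter_upwards [hd.coeFn_toLp] with ω hω
  rw [hω]

lemma tendsto_priceInterval {S : M.priceInterval} {T : ℕ → M.priceInterval}
    (h0 : ∀ n, price₀ (T n) = price₀ S)
    (h : ∀ d : I → ℝ, MemLp d ∞ →
      Tendsto (fun n => ∫ ω, price₁ (T n) ω * d ω) atTop (𝓝 (∫ ω, price₁ S ω * d ω))) :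
    Tendsto T atTop (𝓝 S) := by
  rw [tendsto_subtype_rng, nhds_prod_eq, tendsto_prod_iff']
  refine ⟨(tendsto_congr h0).2 tendsto_const_nhds, ?_⟩
  rw [WeakBilin.instTopologicalSpace, nhds_induced, tendsto_comap_iff, tendsto_pi_nhds]
  intro g
  have := h g (Lp.memLp g)
  simp only [← weakPairing_eq_integral] at this
  exact this

/-- The weight of the ask price when the price is written as a convex combination of the bid and
ask prices. -/
noncomputable def askWeight (S : M.priceInterval) (ω : I) : ℝ :=
  (price₁ S ω - M.bid₁ ω) / (M.ask₁ ω - M.bid₁ ω)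

/-- The spread between the ask and bid prices is at least `α`. -/
abbrev SpreadGE (M : Model) (α : ℝ) : Prop := ∀ᵐ ω, α ≤ M.ask₁ ω - M.bid₁ ω

/-! ### The chord integral as lower semicontinuous envelope -/

section Spread

variable {α : ℝ}

lemma askWeight_mem (hα : 0 < α) (hM : M.SpreadGE α) (S : M.priceInterval) :
    ∀ᵐ ω, 0 ≤ askWeight S ω ∧ askWeight S ω ≤ 1 := by
  filter_upwards [hM, bid_le_price S] with ω h hS
  have hp : 0 < M.ask₁ ω - M.bid₁ ω := hα.trans_le h
  exact ⟨div_nonneg (by linarith) hp.le, (div_le_one hp).2 (by linarith)⟩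

lemma memLp_askWeight (hα : 0 < α) (hM : M.SpreadGE α) (S : M.priceInterval) :
    MemLp (askWeight S) ∞ :=
  memLp_top_of_between (memLp_const 0) (memLp_const 1)
    (((memLp_price₁ S).sub M.bid₁_memLp).aestronglyMeasurable.aemeasurable.div
      (M.ask₁_memLp.sub M.bid₁_memLp).aestronglyMeasurable.aemeasurable).aestronglyMeasurable
    (askWeight_mem hα hM S)

lemma memLp_inv_spread (hα : 0 < α) (hM : M.SpreadGE α) :
    MemLp (fun ω => (M.ask₁ ω - M.bid₁ ω)⁻¹) ∞ := by
  refine memLp_top_of_between (memLp_const 0) (memLp_const α⁻¹)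
    (M.ask₁_memLp.sub M.bid₁_memLp).aestronglyMeasurable.aemeasurable.inv.aestronglyMeasurable ?_
  filter_upwards [hM] with ω h
  exact ⟨inv_nonneg.2 (hα.le.trans h), inv_anti₀ hα h⟩

lemma price_eq_askWeight (hα : 0 < α) (hM : M.SpreadGE α) (S : M.priceInterval) :
    ∀ᵐ ω, price₁ S ω = M.bid₁ ω + askWeight S ω * (M.ask₁ ω - M.bid₁ ω) := by
  filter_upwards [hM] with ω h
  rw [askWeight, div_mul_cancel₀ _ (hα.trans_le h).ne']
  ring

lemma interpolatedUtility_eq (hα : 0 < α) (hM : M.SpreadGE α) (U : ℝ → ℝ) (S : M.priceInterval)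
    (γ : ℝ) : ∀ᵐ ω, interpolatedUtility U S γ ω
      = U (1 + γ * (M.ask₁ ω - price₀ S)) * askWeight S ω
        + U (1 + γ * (M.bid₁ ω - price₀ S)) * (1 - askWeight S ω) := by
  filter_upwards [hM] with ω h
  have hp : M.ask₁ ω - M.bid₁ ω ≠ 0 := (hα.trans_le h).ne'
  rw [interpolatedUtility, askWeight, one_sub_div hp]
  congr 3
  ring

variable {U : ℝ → ℝ}

lemma integrable_interpolatedUtility (hα : 0 < α) (hM : M.SpreadGE α) (hmono : Monotone U)
    (S : M.priceInterval) (γ : ℝ) : Integrable (interpolatedUtility U S γ) := by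
  refine Integrable.congr (MemLp.integrable_of_top ?_)
    ((interpolatedUtility_eq hα hM U S γ).mono fun ω h => h.symm)
  have hp := memLp_askWeight hα hM S
  exact (memLp_top_mul (memLp_top_utility hmono M.ask₁_memLp γ _) hp).add
    (memLp_top_mul (memLp_top_utility hmono M.bid₁_memLp γ _) ((memLp_const 1).sub hp))

lemma integrable_utility (hmono : Monotone U) (S : M.priceInterval) (γ : ℝ) :
    Integrable fun ω => U (1 + γ * (price₁ S ω - price₀ S)) :=
  (memLp_top_utility hmono (memLp_price₁ S) γ _).integrable_of_top

lemma frictionlessUtility_eq (hmono : Monotone U) (S : M.priceInterval) (γ : ℝ) :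
    frictionlessUtility U S γ
      = ((∫ ω, U (1 + γ * (price₁ S ω - price₀ S)) : ℝ) : EReal) :=
  expectedUtility_eq_integral (integrable_utility hmono S γ)

lemma gain_eq_askWeight (hα : 0 < α) (hM : M.SpreadGE α) (S : M.priceInterval) (γ : ℝ) :
    ∀ᵐ ω, 1 + γ * (price₁ S ω - price₀ S)
      = askWeight S ω * (1 + γ * (M.ask₁ ω - price₀ S))
        + (1 - askWeight S ω) * (1 + γ * (M.bid₁ ω - price₀ S)) := by
  filter_upwards [price_eq_askWeight hα hM S] with ω h
  rw [h]
  ring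

lemma interpolatedUtility_le (hα : 0 < α) (hM : M.SpreadGE α) (hconc : ConcaveOn ℝ univ U)
    (S : M.priceInterval) (γ : ℝ) :
    ∀ᵐ ω, interpolatedUtility U S γ ω ≤ U (1 + γ * (price₁ S ω - price₀ S)) := by
  filter_upwards [interpolatedUtility_eq hα hM U S γ, gain_eq_askWeight hα hM S γ,
    askWeight_mem hα hM S] with ω h1 h2 h3
  have := hconc.2 (mem_univ (1 + γ * (M.ask₁ ω - price₀ S)))
    (mem_univ (1 + γ * (M.bid₁ ω - price₀ S))) h3.1 (sub_nonneg.2 h3.2) (by ring)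
  simp only [smul_eq_mul] at this
  rw [h1, h2]
  linarith

lemma integral_interpolatedUtility_le (hα : 0 < α) (hM : M.SpreadGE α) (hmono : Monotone U)
    (hconc : ConcaveOn ℝ univ U) (S : M.priceInterval) (γ : ℝ) :
    ∫ ω, interpolatedUtility U S γ ω ≤ ∫ ω, U (1 + γ * (price₁ S ω - price₀ S)) :=
  integral_mono_ae (integrable_interpolatedUtility hα hM hmono S γ)
    (integrable_utility hmono S γ) (interpolatedUtility_le hα hM hconc S γ)

/-- With `S₀` fixed the integrand is `S₁ d + c`, where `d` is the slope of the chord and `c` does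
not depend on `S`. As `d` lies in `L^∞`, it is an admissible test function. -/
lemma continuous_integral_interpolatedUtility (h₀ : M.bid₀ = M.ask₀) (hα : 0 < α)
    (hM : M.SpreadGE α) (hmono : Monotone U) (γ : ℝ) :
    Continuous fun S : M.priceInterval => ∫ ω, interpolatedUtility U S γ ω := by
  have hua := memLp_top_utility hmono M.ask₁_memLp γ M.bid₀
  have hub := memLp_top_utility hmono M.bid₁_memLp γ M.bid₀
  have hinv := memLp_inv_spread hα hM
  have hd := memLp_top_mul (hua.sub hub) hinv
  have hc := memLp_top_mul ((memLp_top_mul hub M.ask₁_memLp).sub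
    (memLp_top_mul hua M.bid₁_memLp)) hinv
  refine ((continuous_integral_price_mul hd).add (continuous_const (y := ∫ ω,
    (U (1 + γ * (M.bid₁ ω - M.bid₀)) * M.ask₁ ω - U (1 + γ * (M.ask₁ ω - M.bid₀)) * M.bid₁ ω)
      * (M.ask₁ ω - M.bid₁ ω)⁻¹))).congr fun S => ?_
  refine (integral_add (memLp_top_mul (memLp_price₁ S) hd).integrable_of_top
    hc.integrable_of_top).symm.trans (integral_congr_ae (Eventually.of_forall fun ω => ?_))
  simp only [interpolatedUtility, price₀_eq h₀, Pi.sub_apply, div_eq_mul_inv]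
  ring

/-- The ask weight of `S` is replaced by approximating indicators: the ask price on `A n`, the bid
price elsewhere. -/
lemma exists_tendsto_extreme (h₀ : M.bid₀ = M.ask₀) (hα : 0 < α) (hM : M.SpreadGE α)
    (S : M.priceInterval) : ∃ T : ℕ → M.priceInterval, Tendsto T atTop (𝓝 S) ∧
      ∀ n, ∀ᵐ ω, price₁ (T n) ω = M.bid₁ ω ∨ price₁ (T n) ω = M.ask₁ ω := by
  have hp := memLp_askWeight hα hM S
  have hmem := askWeight_mem hα hM S
  obtain ⟨A, hA, hlim⟩ := exists_tendsto_integral_indicator_mul hp.integrable_of_top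
    (hmem.mono fun _ h => h.1) (hmem.mono fun _ h => h.2)
  have hsp := M.ask₁_memLp.sub M.bid₁_memLp
  have hmem' : ∀ n, MemLp (fun ω => M.bid₁ ω
      + (A n).indicator (fun _ => (1 : ℝ)) ω * (M.ask₁ ω - M.bid₁ ω)) ∞ := fun n =>
    M.bid₁_memLp.add (memLp_top_mul ((memLp_const (1 : ℝ)).indicator (hA n)) hsp)
  have hbetween : ∀ n, ∀ᵐ ω, M.bid₁ ω ≤ M.bid₁ ω
        + (A n).indicator (fun _ => (1 : ℝ)) ω * (M.ask₁ ω - M.bid₁ ω) ∧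
      M.bid₁ ω + (A n).indicator (fun _ => (1 : ℝ)) ω * (M.ask₁ ω - M.bid₁ ω) ≤ M.ask₁ ω :=
    fun n => by
      filter_upwards [M.bid₁_le_ask₁] with ω h
      simp only [indicator]
      split_ifs <;> simp [h]
  refine ⟨fun n => priceOf (hmem' n) (hbetween n), ?_, fun n => ?_⟩
  · refine tendsto_priceInterval (fun n => (price₀_eq h₀ S).symm) fun d hd => ?_
    have h := (hlim _ (memLp_top_mul hsp hd).integrable_of_top).add_const
      (∫ ω, price₁ S ω * d ω)
    rw [zero_add] at h
    refine h.congr fun n => ?_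
    rw [← integral_add]
    · refine integral_congr_ae ?_
      filter_upwards [price₁_priceOf (hmem' n) (hbetween n), price_eq_askWeight hα hM S]
        with ω h1 h2
      rw [h1, h2, Pi.sub_apply]
      ring
    · exact (memLp_top_mul (((memLp_const (1 : ℝ)).indicator (hA n)).sub hp)
        (memLp_top_mul hsp hd)).integrable_of_top
    · exact (memLp_top_mul (memLp_price₁ S) hd).integrable_of_top
  · filter_upwards [price₁_priceOf (hmem' n) (hbetween n)] with ω h1
    rw [h1]
    by_cases h : ω ∈ A n <;> simp [h]

lemma interpolatedUtility_eq_of_extreme (hα : 0 < α) (hM : M.SpreadGE α) (U : ℝ → ℝ)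
    {S : M.priceInterval} (hS : ∀ᵐ ω, price₁ S ω = M.bid₁ ω ∨ price₁ S ω = M.ask₁ ω) (γ : ℝ) :
    ∀ᵐ ω, interpolatedUtility U S γ ω = U (1 + γ * (price₁ S ω - price₀ S)) := by
  filter_upwards [hM, hS] with ω h h'
  have hp : M.ask₁ ω - M.bid₁ ω ≠ 0 := (hα.trans_le h).ne'
  rcases h' with h' | h' <;> simp [interpolatedUtility, h', hp]

theorem relaxedUtility_eq (h₀ : M.bid₀ = M.ask₀) (hα : 0 < α) (hM : M.SpreadGE α)
    (hmono : Monotone U) (hconc : ConcaveOn ℝ univ U) (S : M.priceInterval) (γ : ℝ) :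
    relaxedUtility U S γ = ((∫ ω, interpolatedUtility U S γ ω : ℝ) : EReal) := by
  have hcont := (continuous_integral_interpolatedUtility h₀ hα hM hmono γ).tendsto S
  have hcont' := (continuous_coe_real_ereal.tendsto _).comp hcont
  refine le_antisymm (iSup₂_le fun V hV => ?_) (le_of_forall_lt fun c hc => ?_)
  -- Every neighbourhood eventually contains `T n`, where `Ψ` equals the chord integral; pass to the
  -- limit.
  · obtain ⟨T, hT, hext⟩ := exists_tendsto_extreme h₀ hα hM S
    refine ge_of_tendsto (hcont'.comp hT) ?_
    filter_upwards [hT hV] with n hn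
    refine (iInf₂_le (T n) hn).trans_eq ?_
    rw [frictionlessUtility_eq hmono]
    exact congrArg _ (integral_congr_ae ((interpolatedUtility_eq_of_extreme hα hM U (hext n)
      γ).mono fun ω h => h.symm))
  -- On the neighbourhood where the chord integral exceeds `c'`, so does the larger `Ψ`.
  · obtain ⟨c', hc1, hc2⟩ := exists_between hc
    refine hc1.trans_le (le_iSup₂_of_le _ (hcont'.eventually (lt_mem_nhds hc2)) ?_)
    refine le_iInf₂ fun S' hS' => (le_of_lt hS').trans ?_
    rw [frictionlessUtility_eq hmono]
    exact EReal.coe_le_coe_iff.2 (integral_interpolatedUtility_le hα hM hmono hconc S' γ)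

end Spread

end Model

/-! ### Strict inequalities, derivatives and concavity of integrals -/

lemma integral_lt_integral_of_ae_lt {f g : I → ℝ} (hf : Integrable f) (hg : Integrable g)
    (h : ∀ᵐ ω, f ω < g ω) : ∫ ω, f ω < ∫ ω, g ω := by
  refine (integral_mono_ae hf hg (h.mono fun ω h => h.le)).lt_of_ne fun he => ?_
  have h0 := ae_eq_zero_of_integral_eq_zero (hg.sub hf) (h.mono fun ω h => (sub_pos.2 h).le)
    ((integral_sub hg hf).trans (sub_eq_zero.2 he.symm))
  obtain ⟨ω, h1, h2⟩ := (h.and h0).exists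
  exact (sub_pos.2 h1).ne' h2

lemma integral_eq_iff_ae_eq_of_ae_le {f g : I → ℝ} (hf : Integrable f) (hg : Integrable g)
    (h : ∀ᵐ ω, f ω ≤ g ω) : ∫ ω, f ω = ∫ ω, g ω ↔ ∀ᵐ ω, g ω = f ω := by
  refine ⟨fun he => ?_, fun he => (integral_congr_ae he).symm⟩
  exact (ae_eq_zero_of_integral_eq_zero (hg.sub hf) (h.mono fun ω h => sub_nonneg.2 h)
    ((integral_sub hg hf).trans (sub_eq_zero.2 he.symm))).mono fun ω h => sub_eq_zero.1 h

lemma antitone_deriv {U : ℝ → ℝ} (hconc : ConcaveOn ℝ univ U) (hdiff : Differentiable ℝ U) :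
    Antitone (deriv U) := fun x y hxy =>
  hconc.antitoneOn_deriv (fun x _ => hdiff x) (mem_univ x) (mem_univ y) hxy

lemma memLp_top_deriv {U : ℝ → ℝ} (hanti : Antitone (deriv U)) {f : I → ℝ} (hf : MemLp f ∞)
    (γ s : ℝ) : MemLp (fun ω => (f ω - s) * deriv U (1 + γ * (f ω - s))) ∞ := by
  have h := memLp_top_utility hanti.neg hf γ s
  have h' : MemLp (fun ω => deriv U (1 + γ * (f ω - s))) ∞ :=
    (memLp_congr_ae (Eventually.of_forall fun ω => by simp)).1 h.neg
  exact memLp_top_mul (hf.sub (memLp_const s)) h'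

lemma hasDerivAt_integral_utility_mul {U : ℝ → ℝ} (hmono : Monotone U)
    (hanti : Antitone (deriv U)) (hdiff : Differentiable ℝ U) {f p : I → ℝ} (hf : MemLp f ∞)
    (hp : MemLp p ∞) (s γ : ℝ) :
    HasDerivAt (fun γ' => ∫ ω, U (1 + γ' * (f ω - s)) * p ω)
      (∫ ω, (f ω - s) * deriv U (1 + γ * (f ω - s)) * p ω) γ := by
  obtain ⟨C, hC0, hC⟩ := exists_ae_abs_le_of_memLp_top (hf.sub (memLp_const s))
  obtain ⟨D, hD0, hD⟩ := exists_ae_abs_le_of_memLp_top hp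
  -- `R` bounds the wealth for all positions within distance `1` of `γ`. Since `U'` is antitone, `K`
  -- bounds it on `[-R, R]`.
  set R := 1 + (|γ| + 1) * C
  set K := max |deriv U R| |deriv U (-R)|
  refine (hasDerivAt_integral_of_dominated_loc_of_deriv_le (bound := fun _ => C * K * D)
    (F := fun γ' ω => U (1 + γ' * (f ω - s)) * p ω)
    (F' := fun γ' ω => (f ω - s) * deriv U (1 + γ' * (f ω - s)) * p ω)
    (Metric.ball_mem_nhds γ one_pos) (Eventually.of_forall fun γ' => ?_) ?_ ?_ ?_
    (integrable_const _) ?_).2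
  · exact (memLp_top_mul (memLp_top_utility hmono hf γ' s) hp).aestronglyMeasurable
  · exact (memLp_top_mul (memLp_top_utility hmono hf γ s) hp).integrable_of_top
  · exact (memLp_top_mul (memLp_top_deriv hanti hf γ s) hp).aestronglyMeasurable
  · filter_upwards [hC, hD] with ω h1 h2 γ' hγ'
    have hγ : |γ'| ≤ |γ| + 1 := by
      have := abs_sub_abs_le_abs_sub γ' γ
      rw [Metric.mem_ball, Real.dist_eq] at hγ'
      linarith
    have h1' : |f ω - s| ≤ C := h1
    have hR : |1 + γ' * (f ω - s)| ≤ R := by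
      refine (abs_add_le _ _).trans ?_
      rw [abs_one, abs_mul]
      exact add_le_add_right (mul_le_mul hγ h1' (abs_nonneg _) (by positivity)) 1
    have hK : |deriv U (1 + γ' * (f ω - s))| ≤ K :=
      abs_le_max_abs_abs (hanti (abs_le.1 hR).2) (hanti (abs_le.1 hR).1)
    rw [Real.norm_eq_abs, abs_mul, abs_mul]
    gcongr
  · refine Eventually.of_forall fun ω γ' _ => ?_
    have h1 : HasDerivAt (fun γ' : ℝ => 1 + γ' * (f ω - s)) (f ω - s) γ' := by
      simpa using ((hasDerivAt_id γ').mul_const (f ω - s)).const_add 1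
    have h2 := ((hdiff (1 + γ' * (f ω - s))).hasDerivAt.comp γ' h1).mul_const (p ω)
    rw [mul_comm (deriv U _)] at h2
    exact h2

lemma concaveOn_integral_utility_mul {U : ℝ → ℝ} (hmono : Monotone U)
    (hconc : ConcaveOn ℝ univ U) {f p : I → ℝ} (hf : MemLp f ∞) (hp : MemLp p ∞)
    (hp0 : ∀ᵐ ω, 0 ≤ p ω) (s : ℝ) :
    ConcaveOn ℝ univ (fun γ => ∫ ω, U (1 + γ * (f ω - s)) * p ω) := by
  refine ⟨convex_univ, fun x _ y _ c d hc hd hcd => ?_⟩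
  have hint : ∀ γ, Integrable fun ω => U (1 + γ * (f ω - s)) * p ω := fun γ =>
    (memLp_top_mul (memLp_top_utility hmono hf γ s) hp).integrable_of_top
  simp only [smul_eq_mul]
  rw [← integral_const_mul, ← integral_const_mul,
    ← integral_add ((hint x).const_mul c) ((hint y).const_mul d)]
  refine integral_mono_ae (((hint x).const_mul c).add ((hint y).const_mul d)) (hint _) ?_
  filter_upwards [hp0] with ω hω
  have h := hconc.2 (mem_univ (1 + x * (f ω - s))) (mem_univ (1 + y * (f ω - s))) hc hd hcd
  have e : c • (1 + x * (f ω - s)) + d • (1 + y * (f ω - s))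
      = 1 + (c * x + d * y) * (f ω - s) := by
    simp only [smul_eq_mul]
    linear_combination hcd
  rw [e] at h
  simp only [smul_eq_mul] at h
  calc c * (U (1 + x * (f ω - s)) * p ω) + d * (U (1 + y * (f ω - s)) * p ω)
      = (c * U (1 + x * (f ω - s)) + d * U (1 + y * (f ω - s))) * p ω := by ring
    _ ≤ _ := mul_le_mul_of_nonneg_right h hω

lemma le_of_concaveOn_of_hasDerivAt_zero {F : ℝ → ℝ} (hF : ConcaveOn ℝ univ F) {γ : ℝ}
    (h : HasDerivAt F 0 γ) (γ' : ℝ) : F γ' ≤ F γ := by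
  have h' : HasDerivAt (-F) 0 γ := by simpa using h.neg
  have := hF.neg.isMinOn_of_rightDeriv_eq_zero (x := γ) (by simp)
    (h'.hasDerivWithinAt.derivWithin (uniqueDiffWithinAt_Ioi γ)) (mem_univ γ')
  simpa using this

/-! ### The relaxed utility as a function of the position -/

namespace Model

variable {M : Model} {α : ℝ} {U : ℝ → ℝ}

/-- At the mid price the ask weight is `1/2`, and for `γ ≠ 0` the two endpoint wealths differ, so
the chord lies strictly below the graph. -/
lemma exists_integral_interpolatedUtility_lt (hα : 0 < α) (hM : M.SpreadGE α)
    (hmono : Monotone U) (hconc : StrictConcaveOn ℝ univ U) {γ : ℝ} (hγ : γ ≠ 0) :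
    ∃ S : M.priceInterval,
      ∫ ω, interpolatedUtility U S γ ω < ∫ ω, U (1 + γ * (price₁ S ω - price₀ S)) := by
  have hf : MemLp (fun ω => 2⁻¹ * (M.bid₁ ω + M.ask₁ ω)) ∞ :=
    (M.bid₁_memLp.add M.ask₁_memLp).const_mul 2⁻¹
  have hb : ∀ᵐ ω, M.bid₁ ω ≤ 2⁻¹ * (M.bid₁ ω + M.ask₁ ω)
      ∧ 2⁻¹ * (M.bid₁ ω + M.ask₁ ω) ≤ M.ask₁ ω := by
    filter_upwards [M.bid₁_le_ask₁] with ω h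
    constructor <;> linarith
  refine ⟨priceOf hf hb, integral_lt_integral_of_ae_lt
    (integrable_interpolatedUtility hα hM hmono _ γ) (integrable_utility hmono _ γ) ?_⟩
  filter_upwards [interpolatedUtility_eq hα hM U (priceOf hf hb) γ,
    gain_eq_askWeight hα hM (priceOf hf hb) γ, hM, price₁_priceOf hf hb] with ω h1 h2 h3 h4
  have hpos : 0 < M.ask₁ ω - M.bid₁ ω := hα.trans_le h3
  have hw : askWeight (priceOf hf hb) ω = 2⁻¹ := by
    rw [askWeight, h4, div_eq_iff hpos.ne']
    ring
  have hne : 1 + γ * (M.ask₁ ω - price₀ (priceOf hf hb))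
      ≠ 1 + γ * (M.bid₁ ω - price₀ (priceOf hf hb)) := fun h => by
    have := mul_left_cancel₀ hγ (add_left_cancel h)
    linarith
  have := hconc.2 (mem_univ _) (mem_univ _) hne (inv_pos.2 (zero_lt_two' ℝ))
    (inv_pos.2 (zero_lt_two' ℝ)) (by norm_num)
  rw [h1, h2, hw]
  norm_num at this ⊢
  linarith

lemma integral_interpolatedUtility_eq_add (hα : 0 < α) (hM : M.SpreadGE α) (hmono : Monotone U)
    (S : M.priceInterval) (γ : ℝ) :
    ∫ ω, interpolatedUtility U S γ ω
      = (∫ ω, U (1 + γ * (M.ask₁ ω - price₀ S)) * askWeight S ω)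
        + ∫ ω, U (1 + γ * (M.bid₁ ω - price₀ S)) * (1 - askWeight S ω) := by
  have hp := memLp_askWeight hα hM S
  refine (integral_congr_ae (interpolatedUtility_eq hα hM U S γ)).trans (integral_add ?_ ?_)
  · exact (memLp_top_mul (memLp_top_utility hmono M.ask₁_memLp γ _) hp).integrable_of_top
  · exact (memLp_top_mul (memLp_top_utility hmono M.bid₁_memLp γ _)
      ((memLp_const 1).sub hp)).integrable_of_top

lemma concaveOn_integral_interpolatedUtility (hα : 0 < α) (hM : M.SpreadGE α)
    (hmono : Monotone U) (hconc : ConcaveOn ℝ univ U) (S : M.priceInterval) :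
    ConcaveOn ℝ univ fun γ => ∫ ω, interpolatedUtility U S γ ω := by
  have hp := memLp_askWeight hα hM S
  have hmem := askWeight_mem hα hM S
  simp only [integral_interpolatedUtility_eq_add hα hM hmono S]
  exact (concaveOn_integral_utility_mul hmono hconc M.ask₁_memLp hp
    (hmem.mono fun ω h => h.1) _).add (concaveOn_integral_utility_mul hmono hconc M.bid₁_memLp
    ((memLp_const 1).sub hp) (hmem.mono fun ω h => sub_nonneg.2 h.2) _)

lemma integrable_marginalUtility (hconc : ConcaveOn ℝ univ U) (hdiff : Differentiable ℝ U)
    (S : M.priceInterval) (γ : ℝ) : Integrable (marginalUtility U S γ) :=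
  (memLp_top_deriv (antitone_deriv hconc hdiff) (memLp_price₁ S) γ _).integrable_of_top

lemma extremalPrice_of_pos_iff {S : M.priceInterval} {γ : ℝ} (hγ : 0 < γ) :
    ExtremalPrice S γ ↔ ∀ᵐ ω, price₁ S ω = M.bid₁ ω := by
  simp [ExtremalPrice, hγ, hγ.ne', hγ.not_gt]

lemma extremalPrice_of_neg_iff {S : M.priceInterval} {γ : ℝ} (hγ : γ < 0) :
    ExtremalPrice S γ ↔ ∀ᵐ ω, price₁ S ω = M.ask₁ ω := by
  simp [ExtremalPrice, hγ, hγ.ne, hγ.not_gt]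

lemma extremalPrice_zero (S : M.priceInterval) : ExtremalPrice S 0 := by
  simp [ExtremalPrice]

lemma askWeight_eq_zero_iff (hα : 0 < α) (hM : M.SpreadGE α) (S : M.priceInterval) :
    (∀ᵐ ω, askWeight S ω = 0) ↔ ∀ᵐ ω, price₁ S ω = M.bid₁ ω := by
  refine eventually_congr (hM.mono fun ω h => ?_)
  simp [askWeight, (hα.trans_le h).ne', sub_eq_zero]

lemma askWeight_eq_one_iff (hα : 0 < α) (hM : M.SpreadGE α) (S : M.priceInterval) :
    (∀ᵐ ω, askWeight S ω = 1) ↔ ∀ᵐ ω, price₁ S ω = M.ask₁ ω := by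
  refine eventually_congr (hM.mono fun ω h => ?_)
  rw [askWeight, div_eq_one_iff_eq (hα.trans_le h).ne', sub_left_inj]

/-- The derivative interpolates the marginal utilities at bid and ask. This is the marginal utility
at `S₁` if the weight is `0` or `1`, and also if `γ = 0`, where `x ↦ (x - S₀) U'(1)` is affine. -/
lemma hasDerivAt_integral_interpolatedUtility (hα : 0 < α) (hM : M.SpreadGE α)
    (hmono : Monotone U) (hconc : ConcaveOn ℝ univ U) (hdiff : Differentiable ℝ U)
    {S : M.priceInterval} {γ : ℝ} (hS : ExtremalPrice S γ) :
    HasDerivAt (fun γ' => ∫ ω, interpolatedUtility U S γ' ω)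
      (∫ ω, marginalUtility U S γ ω) γ := by
  have hp := memLp_askWeight hα hM S
  have hanti := antitone_deriv hconc hdiff
  have hq : MemLp (fun ω => 1 - askWeight S ω) ∞ := (memLp_const 1).sub hp
  have h := (hasDerivAt_integral_utility_mul hmono hanti hdiff M.ask₁_memLp hp (price₀ S) γ).add
    (hasDerivAt_integral_utility_mul hmono hanti hdiff M.bid₁_memLp hq (price₀ S) γ)
  have e : ∫ ω, marginalUtility U S γ ω
      = (∫ ω, (M.ask₁ ω - price₀ S) * deriv U (1 + γ * (M.ask₁ ω - price₀ S)) * askWeight S ω)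
        + ∫ ω, (M.bid₁ ω - price₀ S) * deriv U (1 + γ * (M.bid₁ ω - price₀ S))
          * (1 - askWeight S ω) := by
    rw [← integral_add
      (memLp_top_mul (memLp_top_deriv hanti M.ask₁_memLp γ _) hp).integrable_of_top
      (memLp_top_mul (memLp_top_deriv hanti M.bid₁_memLp γ _) hq).integrable_of_top]
    refine integral_congr_ae ?_
    rcases lt_trichotomy γ 0 with hγ | rfl | hγ
    · have h1 := (extremalPrice_of_neg_iff hγ).1 hS
      filter_upwards [h1, (askWeight_eq_one_iff hα hM S).2 h1] with ω h1 h2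
      simp [marginalUtility, h1, h2]
    · filter_upwards [price_eq_askWeight hα hM S] with ω h1
      simp only [marginalUtility, zero_mul, add_zero]
      rw [h1]
      ring
    · have h1 := (extremalPrice_of_pos_iff hγ).1 hS
      filter_upwards [h1, (askWeight_eq_zero_iff hα hM S).2 h1] with ω h1 h2
      simp [marginalUtility, h1, h2]
  rw [e]
  exact h.congr_of_eventuallyEq
    (Eventually.of_forall fun γ' => integral_interpolatedUtility_eq_add hα hM hmono S γ')

/-! ### Wealth under transaction costs and saddle points -/

lemma wealth_of_nonneg (h₀ : M.bid₀ = M.ask₀) {γ : ℝ} (hγ : 0 ≤ γ) (ω : I) :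
    M.wealth γ ω = 1 + γ * (M.bid₁ ω - M.bid₀) := by
  simp only [wealth, ← h₀, sub_zero, zero_sub, neg_neg, max_eq_left hγ,
    max_eq_right (neg_nonpos.2 hγ)]
  ring

lemma wealth_of_nonpos (h₀ : M.bid₀ = M.ask₀) {γ : ℝ} (hγ : γ ≤ 0) (ω : I) :
    M.wealth γ ω = 1 + γ * (M.ask₁ ω - M.bid₀) := by
  simp only [wealth, ← h₀, sub_zero, zero_sub, neg_neg, max_eq_right hγ,
    max_eq_left (neg_nonneg.2 hγ)]
  ring

lemma integrable_utility_wealth (h₀ : M.bid₀ = M.ask₀) (hmono : Monotone U) (γ : ℝ) :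
    Integrable fun ω => U (M.wealth γ ω) := by
  rcases le_total 0 γ with hγ | hγ
  · simpa only [wealth_of_nonneg h₀ hγ] using
      (memLp_top_utility hmono M.bid₁_memLp γ M.bid₀).integrable_of_top
  · simpa only [wealth_of_nonpos h₀ hγ] using
      (memLp_top_utility hmono M.ask₁_memLp γ M.bid₀).integrable_of_top

lemma value_eq_iSup (h₀ : M.bid₀ = M.ask₀) (hmono : Monotone U) :
    M.value U = ⨆ γ : ℝ, ((∫ ω, U (M.wealth γ ω) : ℝ) : EReal) :=
  iSup_congr fun γ => expectedUtility_eq_integral (integrable_utility_wealth h₀ hmono γ)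

/-- The left side is the smaller of the two endpoint utilities, the right side a weighted mean of
both. -/
lemma utility_wealth_le (h₀ : M.bid₀ = M.ask₀) (hα : 0 < α) (hM : M.SpreadGE α)
    (hmono : Monotone U) (S : M.priceInterval) (γ : ℝ) :
    ∀ᵐ ω, U (M.wealth γ ω) ≤ interpolatedUtility U S γ ω := by
  filter_upwards [interpolatedUtility_eq hα hM U S γ, askWeight_mem hα hM S,
    M.bid₁_le_ask₁] with ω h1 h2 h3
  rw [h1, price₀_eq h₀]
  rcases le_total 0 γ with hγ | hγ
  · rw [wealth_of_nonneg h₀ hγ]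
    have : U (1 + γ * (M.bid₁ ω - M.bid₀)) ≤ U (1 + γ * (M.ask₁ ω - M.bid₀)) :=
      hmono (by gcongr)
    nlinarith [mul_le_mul_of_nonneg_right this h2.1]
  · rw [wealth_of_nonpos h₀ hγ]
    have : U (1 + γ * (M.ask₁ ω - M.bid₀)) ≤ U (1 + γ * (M.bid₁ ω - M.bid₀)) :=
      hmono (by nlinarith)
    nlinarith [mul_le_mul_of_nonneg_right this (sub_nonneg.2 h2.2)]

lemma integral_utility_wealth_le (h₀ : M.bid₀ = M.ask₀) (hα : 0 < α) (hM : M.SpreadGE α)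
    (hmono : Monotone U) (S : M.priceInterval) (γ : ℝ) :
    ∫ ω, U (M.wealth γ ω) ≤ ∫ ω, interpolatedUtility U S γ ω :=
  integral_mono_ae (integrable_utility_wealth h₀ hmono γ)
    (integrable_interpolatedUtility hα hM hmono S γ) (utility_wealth_le h₀ hα hM hmono S γ)

/-- For `γ ≠ 0` the endpoint utilities differ strictly, so equality forces all weight onto the worse
endpoint. For `γ = 0` both sides are `U 1`. -/
lemma integral_utility_wealth_eq_iff (h₀ : M.bid₀ = M.ask₀) (hα : 0 < α) (hM : M.SpreadGE α)
    (hmono : StrictMono U) (S : M.priceInterval) (γ : ℝ) :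
    ∫ ω, U (M.wealth γ ω) = ∫ ω, interpolatedUtility U S γ ω ↔ ExtremalPrice S γ := by
  rw [integral_eq_iff_ae_eq_of_ae_le (integrable_utility_wealth h₀ hmono.monotone γ)
    (integrable_interpolatedUtility hα hM hmono.monotone S γ)
    (utility_wealth_le h₀ hα hM hmono.monotone S γ)]
  rcases lt_trichotomy γ 0 with hγ | rfl | hγ
  · rw [extremalPrice_of_neg_iff hγ, ← askWeight_eq_one_iff hα hM]
    refine eventually_congr ?_
    filter_upwards [interpolatedUtility_eq hα hM U S γ, hM] with ω h1 h2
    have : U (1 + γ * (M.ask₁ ω - M.bid₀)) < U (1 + γ * (M.bid₁ ω - M.bid₀)) :=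
      hmono (by nlinarith)
    rw [h1, price₀_eq h₀, wealth_of_nonpos h₀ hγ.le]
    refine ⟨fun h => ?_, fun h => by rw [h]; ring⟩
    refine (mul_left_cancel₀ (sub_pos.2 this).ne' ?_)
    linear_combination -h
  · refine iff_of_true ?_ (extremalPrice_zero S)
    filter_upwards [interpolatedUtility_eq hα hM U S 0] with ω h1
    rw [h1, wealth_of_nonneg h₀ le_rfl]
    simp only [zero_mul, add_zero]
    ring
  · rw [extremalPrice_of_pos_iff hγ, ← askWeight_eq_zero_iff hα hM]
    refine eventually_congr ?_
    filter_upwards [interpolatedUtility_eq hα hM U S γ, hM] with ω h1 h2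
    have : U (1 + γ * (M.bid₁ ω - M.bid₀)) < U (1 + γ * (M.ask₁ ω - M.bid₀)) :=
      hmono (by nlinarith)
    rw [h1, price₀_eq h₀, wealth_of_nonneg h₀ hγ.le]
    refine ⟨fun h => ?_, fun h => by rw [h]; ring⟩
    refine (mul_left_cancel₀ (sub_pos.2 this).ne' ?_)
    linear_combination h

lemma exists_extremalPrice (M : Model) (γ : ℝ) : ∃ S : M.priceInterval, ExtremalPrice S γ := by
  rcases lt_trichotomy γ 0 with hγ | rfl | hγ
  · exact ⟨priceOf M.ask₁_memLp (M.bid₁_le_ask₁.mono fun ω h => ⟨h, le_rfl⟩),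
      (extremalPrice_of_neg_iff hγ).2 (price₁_priceOf _ _)⟩
  · exact ⟨priceOf M.ask₁_memLp (M.bid₁_le_ask₁.mono fun ω h => ⟨h, le_rfl⟩),
      extremalPrice_zero _⟩
  · exact ⟨priceOf M.bid₁_memLp (M.bid₁_le_ask₁.mono fun ω h => ⟨le_rfl, h⟩),
      (extremalPrice_of_pos_iff hγ).2 (price₁_priceOf _ _)⟩

lemma isSaddlePoint_iff_extremalPrice_and_max (h₀ : M.bid₀ = M.ask₀) (hα : 0 < α)
    (hM : M.SpreadGE α) (hmono : StrictMono U) (hconc : ConcaveOn ℝ univ U)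
    (S : M.priceInterval) (γ : ℝ) :
    IsSaddlePoint U S γ ↔ ExtremalPrice S γ ∧
      ∀ γ', ∫ ω, interpolatedUtility U S γ' ω ≤ ∫ ω, interpolatedUtility U S γ ω := by
  simp only [IsSaddlePoint, relaxedUtility_eq h₀ hα hM hmono.monotone hconc,
    EReal.coe_le_coe_iff]
  refine ⟨fun h => ⟨?_, fun γ' => (h S γ').1⟩, fun h S' γ' => ⟨h.2 γ', ?_⟩⟩
  -- `S'` attains the lower bound `𝔼 U(X₁(γ))`, so the minimiser `S` attains it too and is extremal.
  · obtain ⟨S', hS'⟩ := exists_extremalPrice M γ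
    rw [← integral_utility_wealth_eq_iff h₀ hα hM hmono] at hS' ⊢
    exact le_antisymm (integral_utility_wealth_le h₀ hα hM hmono.monotone S γ)
      ((h S' γ).2.trans_eq hS'.symm)
  · rw [← (integral_utility_wealth_eq_iff h₀ hα hM hmono S γ).2 h.1]
    exact integral_utility_wealth_le h₀ hα hM hmono.monotone S' γ

theorem isSaddlePoint_iff (h₀ : M.bid₀ = M.ask₀) (hα : 0 < α) (hM : M.SpreadGE α)
    (hmono : StrictMono U) (hconc : ConcaveOn ℝ univ U) (hdiff : Differentiable ℝ U)
    (S : M.priceInterval) (γ : ℝ) :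
    IsSaddlePoint U S γ ↔ ExtremalPrice S γ ∧ ∫ ω, marginalUtility U S γ ω = 0 := by
  rw [isSaddlePoint_iff_extremalPrice_and_max h₀ hα hM hmono hconc]
  refine and_congr_right fun hS => ?_
  have hd := hasDerivAt_integral_interpolatedUtility hα hM hmono.monotone hconc hdiff hS
  refine ⟨fun h => ?_, fun h => ?_⟩
  · exact IsLocalMax.hasDerivAt_eq_zero (Eventually.of_forall h) hd
  · exact le_of_concaveOn_of_hasDerivAt_zero
      (concaveOn_integral_interpolatedUtility hα hM hmono.monotone hconc S) (h ▸ hd)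

lemma integral_utility_le_of_marginal_eq_zero (hmono : Monotone U)
    (hconc : ConcaveOn ℝ univ U) (hdiff : Differentiable ℝ U) {S : M.priceInterval} {γ : ℝ}
    (h : ∫ ω, marginalUtility U S γ ω = 0) (γ' : ℝ) :
    ∫ ω, U (1 + γ' * (price₁ S ω - price₀ S)) ≤ ∫ ω, U (1 + γ * (price₁ S ω - price₀ S)) := by
  have h1 : MemLp (fun _ : I => (1 : ℝ)) ∞ := memLp_const 1
  have hd := hasDerivAt_integral_utility_mul hmono (antitone_deriv hconc hdiff) hdiff
    (memLp_price₁ S) h1 (price₀ S) γ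
  have hc := concaveOn_integral_utility_mul hmono hconc (memLp_price₁ S) h1
    (Eventually.of_forall fun _ => zero_le_one) (price₀ S)
  simp only [mul_one] at hd hc
  exact le_of_concaveOn_of_hasDerivAt_zero hc (h ▸ hd) γ'

lemma integral_interpolatedUtility_eq_of_extremalPrice (hα : 0 < α) (hM : M.SpreadGE α)
    {S : M.priceInterval} {γ : ℝ} (hS : ExtremalPrice S γ) :
    ∫ ω, interpolatedUtility U S γ ω = ∫ ω, U (1 + γ * (price₁ S ω - price₀ S)) := by
  refine integral_congr_ae ?_
  rcases lt_trichotomy γ 0 with hγ | rfl | hγ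
  · exact interpolatedUtility_eq_of_extreme hα hM U
      (((extremalPrice_of_neg_iff hγ).1 hS).mono fun ω h => Or.inr h) γ
  · filter_upwards [interpolatedUtility_eq hα hM U S 0] with ω h
    rw [h]
    simp only [zero_mul, add_zero]
    ring
  · exact interpolatedUtility_eq_of_extreme hα hM U
      (((extremalPrice_of_pos_iff hγ).1 hS).mono fun ω h => Or.inl h) γ

/-! ### Generalized shadow prices, saddle points and shadow prices -/

theorem isGeneralizedShadowPrice_iff_isSaddlePoint (h₀ : M.bid₀ = M.ask₀) (hα : 0 < α)
    (hM : M.SpreadGE α) (hmono : StrictMono U) (hconc : ConcaveOn ℝ univ U) {γ : ℝ}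
    (hγ : M.IsOptimal U γ) (S : M.priceInterval) :
    IsGeneralizedShadowPrice U S ↔ IsSaddlePoint U S γ := by
  have hopt : ((∫ ω, U (M.wealth γ ω) : ℝ) : EReal) = M.value U := by
    rw [← expectedUtility_eq_integral (integrable_utility_wealth h₀ hmono.monotone γ)]
    exact hγ
  rw [isSaddlePoint_iff_extremalPrice_and_max h₀ hα hM hmono hconc,
    ← integral_utility_wealth_eq_iff h₀ hα hM hmono, IsGeneralizedShadowPrice, ← hopt]
  simp only [relaxedUtility_eq h₀ hα hM hmono.monotone hconc]
  refine ⟨fun h => ?_, fun h => ?_⟩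
  · have hle : ∀ γ', ∫ ω, interpolatedUtility U S γ' ω ≤ ∫ ω, U (M.wealth γ ω) := fun γ' => by
      rw [← EReal.coe_le_coe_iff, ← h]
      exact le_iSup (fun γ' => ((∫ ω, interpolatedUtility U S γ' ω : ℝ) : EReal)) γ'
    -- Optimality of `γ` squeezes `Ψ̂(S, γ)` between `λ` and `λ`.
    have he := le_antisymm (integral_utility_wealth_le h₀ hα hM hmono.monotone S γ) (hle γ)
    exact ⟨he, fun γ' => he ▸ hle γ'⟩
  · rw [h.1]
    exact le_antisymm (iSup_le fun γ' => EReal.coe_le_coe_iff.2 (h.2 γ'))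
      (le_iSup (fun γ' => ((∫ ω, interpolatedUtility U S γ' ω : ℝ) : EReal)) γ)

theorem isGeneralizedShadowPrice_iff_isShadowPrice (h₀ : M.bid₀ = M.ask₀) (hα : 0 < α)
    (hM : M.SpreadGE α) (hmono : StrictMono U) (hconc : ConcaveOn ℝ univ U)
    (hdiff : Differentiable ℝ U) {γ : ℝ} (hγ : M.IsOptimal U γ) (S : M.priceInterval) :
    IsGeneralizedShadowPrice U S ↔ IsShadowPrice U S := by
  have hle : ⨆ γ', relaxedUtility U S γ' ≤ ⨆ γ', frictionlessUtility U S γ' :=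
    iSup_mono fun γ' => by
      rw [relaxedUtility_eq h₀ hα hM hmono.monotone hconc, frictionlessUtility_eq hmono.monotone]
      exact EReal.coe_le_coe_iff.2 (integral_interpolatedUtility_le hα hM hmono.monotone hconc S γ')
  have hle' : M.value U ≤ ⨆ γ', relaxedUtility U S γ' := by
    rw [value_eq_iSup h₀ hmono.monotone]
    refine iSup_mono fun γ' => ?_
    rw [relaxedUtility_eq h₀ hα hM hmono.monotone hconc]
    exact EReal.coe_le_coe_iff.2 (integral_utility_wealth_le h₀ hα hM hmono.monotone S γ')
  refine ⟨fun h => le_antisymm ?_ (hle'.trans hle),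
    fun h => le_antisymm (hle.trans_eq h) hle'⟩
  -- Only `sup Ψ ≤ λ` remains. The saddle point makes `γ` a maximiser of `Ψ(S, ·)`, and by
  -- extremality its value there is `Ψ̂(S, γ)`.
  have hs := (isGeneralizedShadowPrice_iff_isSaddlePoint h₀ hα hM hmono hconc hγ S).1 h
  obtain ⟨hext, hmarg⟩ := (isSaddlePoint_iff h₀ hα hM hmono hconc hdiff S γ).1 hs
  refine iSup_le fun γ' => ?_
  rw [← h, frictionlessUtility_eq hmono.monotone]
  refine le_iSup_of_le γ ?_
  rw [relaxedUtility_eq h₀ hα hM hmono.monotone hconc,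
    integral_interpolatedUtility_eq_of_extremalPrice hα hM hext]
  exact EReal.coe_le_coe_iff.2
    (integral_utility_le_of_marginal_eq_zero hmono.monotone hconc hdiff hmarg γ')

end Model

end ShadowPrice

open ShadowPrice ShadowPrice.Model in
theorem mainTheorem5 (M : Model) (h₀ : M.bid₀ = M.ask₀)
    (α : ℝ) (hα : 0 < α) (hspread : ∀ᵐ ω, α ≤ M.ask₁ ω - M.bid₁ ω)
    (U : ℝ → ℝ) (hmono : Monotone U) (hconc : ConcaveOn ℝ Set.univ U) :
    (∀ (S : M.priceInterval) (γ : ℝ),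
      Integrable (interpolatedUtility U S γ) ∧
      relaxedUtility U S γ = ((∫ ω, interpolatedUtility U S γ ω : ℝ) : EReal)) ∧
    (StrictConcaveOn ℝ Set.univ U →
      ∀ γ : ℝ, γ ≠ 0 → ∃ S : M.priceInterval,
        relaxedUtility U S γ < frictionlessUtility U S γ) ∧
    (StrictMono U → Differentiable ℝ U →
      (∀ (S : M.priceInterval) (γ : ℝ),
        Integrable (marginalUtility U S γ) ∧
        (ExtremalPrice S γ →
          HasDerivAt (fun γ' => (relaxedUtility U S γ').toReal)
            (∫ ω, marginalUtility U S γ ω) γ) ∧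
        (IsSaddlePoint U S γ ↔ ExtremalPrice S γ ∧ ∫ ω, marginalUtility U S γ ω = 0)) ∧
      (∀ γ : ℝ, M.IsOptimal U γ → ∀ S : M.priceInterval,
        (IsGeneralizedShadowPrice U S ↔ IsSaddlePoint U S γ) ∧
        (IsGeneralizedShadowPrice U S ↔ IsShadowPrice U S))) := by
  refine ⟨fun S γ => ⟨integrable_interpolatedUtility hα hspread hmono S γ,
    relaxedUtility_eq h₀ hα hspread hmono hconc S γ⟩, fun hstrict γ hγ => ?_,
    fun hU hdiff => ⟨fun S γ => ⟨integrable_marginalUtility hconc hdiff S γ, fun hS => ?_,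
      isSaddlePoint_iff h₀ hα hspread hU hconc hdiff S γ⟩, fun γ hγ S =>
      ⟨isGeneralizedShadowPrice_iff_isSaddlePoint h₀ hα hspread hU hconc hγ S,
        isGeneralizedShadowPrice_iff_isShadowPrice h₀ hα hspread hU hconc hdiff hγ S⟩⟩⟩
  · obtain ⟨S, hS⟩ := exists_integral_interpolatedUtility_lt hα hspread hmono hstrict hγ
    refine ⟨S, ?_⟩
    rw [relaxedUtility_eq h₀ hα hspread hmono hconc, frictionlessUtility_eq hmono]
    exact EReal.coe_lt_coe_iff.2 hS
  · simp only [relaxedUtility_eq h₀ hα hspread hmono hconc, EReal.toReal_coe]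
    exact hasDerivAt_integral_interpolatedUtility hα hspread hmono hconc hdiff hS
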